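/- **The least stabilizing ordinal is countable.** *Language.* Expressions are terms and formulas: noemata $v_0,v_1,\dots$, the alethizor $\mathrm T$ and the enumerator $€$ are terms; if $a,b$ are terms, $a\in b$ is a formula (written $ba$ in Polish notation) and $\downarrow ab$ is a term; if $A,B$ are formulas and $y$ is a noema, $\downarrow AB$ and $\forall yA$ are formulas and $\{y\mid A\}$ is a term. Noemata are bound by $\forall y$ and $\{y\mid\cdot\}$; a *cognomen* is a term, and a *proposition* a formula, in which no noema is free. $A(a/u)$ is the substitution of $a$ for the free noema $u$, and $F(a,u,A)$ says that $a$ is substitutable for $u$ in $A$: recursively, no part $\forall yB$ or $\{y\mid B\}$ of $A$ has both $y$ free in $a$ and $u$ free in $B$. The connectives are defined from $\downarrow$ (neither-nor); $a=b$ is $\forall u(a\in u\to b\in u)$; $\mathbb TA$ is $\exists y(y\in\{y\mid A\})$ with $y$ the first noema not free in $A$; $\langle a,b\rangle=\{\{a\},\{a,b\}\}$ with $\{a,b\}=\{x\mid x=a\vee x=b\}$ and $\{a\}=\{a,a\}$. An expression has as its number the binary numeral obtained from its Polish notation, with $2^0,2^1,2^2,2^3,2^4,2^{n+5}$ for $\{\cdot\mid\cdot\},\forall,\downarrow,\mathrm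 T,€,v_n$. The term $\ulcorner 0\urcorner$ is $\{v_0\mid\neg\forall v_1(v_0\in v_1\to v_0\in v_1)\}$, $\ulcorner n+1\urcorner$ is $\{v_0\mid v_0\in\ulcorner n\urcorner\vee\forall v_1(v_0\in v_1\to\ulcorner n\urcorner\in v_1)\}$, and $\ulcorner A\urcorner$ is $\ulcorner n\urcorner$ for the number $n$ of $A$. *Enumeration.* Alphabetological variance is the least relation, between propositions and between cognomina, such that: $A$ is a variant of $B$ if $A\leftrightarrow B$ is provable in classical logic, or if $A$ is a variant of the result of replacing $b$ by $a$ in $B$, for some cognomina $a,b$ with $a$ a variant of $b$; $\mathrm T$ and $€$ are variants of themselves; $\downarrow cd$ is a variant of $\downarrow ef$ if $c,d$ are variants of $e,f$ respectively or of $f,e$ respectively; $\{x\mid A\}$ is a variant of $\{y\mid B\}$ if $\exists xA$ is a variant of $\exists yB$. Let $c_0,c_1,\dots$ enumerate cognomina so that $c_n$ has the smallest number among the cognomina $b$ such that no $c_m$ with $m<n$ is a variant of $b$ (ties broken arbitrarily). *Process.* By recursion on the ordinals $\alpha$ one defines which formulas hold at $\alpha$ ($\alpha\vDash A$). Say that $B$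 holds *eventually below* $\alpha$ if there is $\beta<\alpha$ such that $\gamma\vDash B$ whenever $\beta\le\gamma<\alpha$. Cognomina $a,b$ are *identical at* $\alpha$ if for all cognomina $\{u\mid A\}$, $A(a/u)$ holds eventually below $\alpha$ iff $A(b/u)$ does. At $\alpha$, the noema $v_n$ names the cognomen $c_n$ if $c_n$ is not identical at $\alpha$ with what $v_m$ names, for any $m<n$; otherwise $v_n$ names what $v_{n-1}$ names. For an expression $X$ let $X^\alpha$ be $X$ with each free noema replaced by the cognomen that it names at $\alpha$. Then: - for cognomina $a$ and $\{u\mid A\}$: $\alpha\vDash a\in\{u\mid A\}$ iff $F(a,u,A)$ and $A(a/u)$ holds eventually below $\alpha$; - for cognomina $a,b,d$: $\alpha\vDash a\in\downarrow bd$ iff neither $\alpha\vDash a\in b$ nor $\alpha\vDash a\in d$; - for a cognomen $a$: $\alpha\vDash a\in\mathrm T$ iff for some formula $A$, $a$ is identical with $\ulcorner A\urcorner$ at $\alpha$ and $A^\alpha$ holds eventually below $\alpha$; - for a cognomen $a$: $\alpha\vDash a\in €$ iff for some term $d$ and natural number $n$, $a$ is identical at $\alpha$ with $\langle\ulcorner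 n\urcorner,d\rangle^\alpha$, and $d^\alpha$ is identical at $\alpha$ with the cognomen that $v_n$ names at $\alpha$; - for all terms $a,b$: $\alpha\vDash a\in b$ iff $\alpha\vDash a^\alpha\in b^\alpha$; - for all formulas: $\alpha\vDash\downarrow AB$ iff neither $\alpha\vDash A$ nor $\alpha\vDash B$; and $\alpha\vDash\forall yA$ iff $\alpha\vDash A(a/y)$ for all terms $a$ with $F(a,y,A)$. *Stabilization.* Let $\vDash_\gamma=\{A:\gamma\vDash\mathbb TA\}$. Let $IN$ be the set of formulas $A$ such that for some $\beta$, $A\in\vDash_\gamma$ for all $\gamma\ge\beta$; $OUT$ the set of those such that for some $\beta$, $A\notin\vDash_\gamma$ for all $\gamma\ge\beta$; $UNSTAB$ the set of all other formulas. A limit ordinal $\kappa$ *covers* the process if $IN\subseteq\vDash_\gamma\subseteq IN\cup UNSTAB$ for all $\gamma\ge\kappa$; a limit ordinal $\sigma$ *stabilizes* the process if it covers it and $\vDash_\sigma\subseteq IN$. **Lemma.** There is a least ordinal that stabilizes the process (the closure ordinal), and it is countable. -/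

import Mathlib

namespace Librationism

/-! ### The language -/

/-- The two kinds of expressions: terms (nomina) and formulas (sentences). -/
inductive Kind where
  | term
  | formula

/-- Expressions, as syntax trees. `noema n` is the noema `v_n`, `alethizor` is `T`, `enumerator` is
`€`, `app b a` is the atomic formula `ba`, that is `a ∈ b`, `joint X Y` is `↓XY` (both for two
terms and for two formulas), `all y A` is `∀ v_y A` and `sort y A` is the sort `{v_y | A}`. -/
inductive Expr : Kind → Type where
  | noema (n : ℕ) : Expr .term
  | alethizor : Expr .term
  | enumerator : Expr .term
  | app (b a : Expr .term) : Expr .formula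
  | joint {k : Kind} (X Y : Expr k) : Expr k
  | all (y : ℕ) (A : Expr .formula) : Expr .formula
  | sort (y : ℕ) (A : Expr .formula) : Expr .term

abbrev Term := Expr .term
abbrev Formula := Expr .formula

namespace Expr

/-- The (indices of the) noemata present in an expression. -/
def noemata : {k : Kind} → Expr k → Finset ℕ
  | _, noema n => {n}
  | _, alethizor => ∅
  | _, enumerator => ∅
  | _, app b a => noemata b ∪ noemata a
  | _, joint X Y => noemata X ∪ noemata Y
  | _, all y A => noemata A \ {y}
  | _, sort y A => noemata A \ {y}

/-- No noema is present: a closed term is a cognomen, a closed formula is a proposition. -/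
def Closed {k : Kind} (X : Expr k) : Prop := X.noemata = ∅

/-- `X.subst a u` is `X(a/v_u)`. -/
def subst : {k : Kind} → Expr k → Term → ℕ → Expr k
  | _, noema n, a, u => if n = u then a else noema n
  | _, alethizor, _, _ => alethizor
  | _, enumerator, _, _ => enumerator
  | _, app b c, a, u => app (subst b a u) (subst c a u)
  | _, joint X Y, a, u => joint (subst X a u) (subst Y a u)
  | _, all y A, a, u => if y = u then all y A else all y (subst A a u)
  | _, sort y A, a, u => if y = u then sort y A else sort y (subst A a u)

/-- `X.Free a u`: the term `a` is substitutable for the noema `v_u` in `X`. -/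
def Free : {k : Kind} → Expr k → Term → ℕ → Prop
  | _, noema _, _, _ => True
  | _, alethizor, _, _ => True
  | _, enumerator, _, _ => True
  | _, app b c, a, u => Free b a u ∧ Free c a u
  | _, joint X Y, a, u => Free X a u ∧ Free Y a u
  | _, all y A, a, u => (y ∉ a.noemata ∨ u ∉ A.noemata) ∧ Free A a u
  | _, sort y A, a, u => (y ∉ a.noemata ∨ u ∉ A.noemata) ∧ Free A a u

/-- Simultaneous replacement of every noema present in an expression by the term that `ρ` gives
it. It is used with cognomina only, so that nothing can be captured. -/
def inst : {k : Kind} → Expr k → (ℕ → Term) → Expr k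
  | _, noema n, ρ => ρ n
  | _, alethizor, _ => alethizor
  | _, enumerator, _ => enumerator
  | _, app b c, ρ => app (inst b ρ) (inst c ρ)
  | _, joint X Y, ρ => joint (inst X ρ) (inst Y ρ)
  | _, all y A, ρ => all y (inst A (Function.update ρ y (noema y)))
  | _, sort y A, ρ => sort y (inst A (Function.update ρ y (noema y)))

open Classical in
/-- `X.replace b a` is `X(a/b)` for terms `a` and `b`: all occurrences of `b` in `X` are replaced
by `a`. -/
noncomputable def replace : {k : Kind} → Expr k → Term → Term → Expr k
  | _, noema n, b, a => if noema n = b then a else noema n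
  | _, alethizor, b, a => if alethizor = b then a else alethizor
  | _, enumerator, b, a => if enumerator = b then a else enumerator
  | _, app c d, b, a => app (replace c b a) (replace d b a)
  | .term, joint X Y, b, a =>
    if joint X Y = b then a else joint (replace X b a) (replace Y b a)
  | .formula, joint X Y, b, a => joint (replace X b a) (replace Y b a)
  | _, all y A, b, a => all y (replace A b a)
  | _, sort y A, b, a => if sort y A = b then a else sort y (replace A b a)

/-! Defined connectives and terms. -/

def neg (A : Formula) : Formula := joint A A
def disj (A B : Formula) : Formula := joint (joint A B) (joint A B)
def conj (A B : Formula) : Formula := joint (joint A A) (joint B B)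
def imp (A B : Formula) : Formula := joint (joint (joint A A) B) (joint (joint A A) B)
def biimp (A B : Formula) : Formula := conj (imp A B) (imp B A)
def ex (y : ℕ) (A : Formula) : Formula := neg (all y (neg A))

/-- The (index of the) first noema not in `s`. -/
noncomputable def fresh (s : Finset ℕ) : ℕ := sInf {n | n ∉ s}

/-- The defined truth operator `𝕋A`, that is `∃y (y ∈ {y|A})` for the first noema `y` that is not
present in `A`. -/
noncomputable def truth (A : Formula) : Formula :=
  ex (fresh A.noemata) (app (sort (fresh A.noemata) A) (noema (fresh A.noemata)))

/-- `a = b`, that is `∀u (a ∈ u → b ∈ u)`. -/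
noncomputable def eqv (a b : Term) : Formula :=
  all (fresh (a.noemata ∪ b.noemata))
    (imp (app (noema (fresh (a.noemata ∪ b.noemata))) a)
      (app (noema (fresh (a.noemata ∪ b.noemata))) b))

/-- The unordered pair `{x | x = a ∨ x = b}`. -/
noncomputable def upair (a b : Term) : Term :=
  sort (fresh (a.noemata ∪ b.noemata))
    (disj (eqv (noema (fresh (a.noemata ∪ b.noemata))) a)
      (eqv (noema (fresh (a.noemata ∪ b.noemata))) b))

/-- The ordered pair `⟨a, b⟩` of Kuratowski. -/
noncomputable def pair (a b : Term) : Term := upair (upair a a) (upair a b)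

/-! ### Expressions as numbers, and their codes -/

/-- `m ⌢ n`: concatenation of binary numerals. -/
def concat (m n : ℕ) : ℕ := m * 2 ^ n.size + n

/-- The natural number of an expression: its Polish notation read as a binary numeral, where the
symbol `|_n` is the numeral `10…0` with `n` zeros. -/
def num : {k : Kind} → Expr k → ℕ
  | _, noema n => 2 ^ (n + 5)
  | _, alethizor => 2 ^ 3
  | _, enumerator => 2 ^ 4
  | _, app b a => concat (num b) (num a)
  | _, joint X Y => concat (2 ^ 2) (concat (num X) (num Y))
  | _, all y A => concat (2 ^ 1) (concat (2 ^ (y + 5)) (num A))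
  | _, sort y A => concat (2 ^ 0) (concat (2 ^ (y + 5)) (num A))

/-- The term that names a natural number: `⌜0⌝` is `{v₀ | ¬∀v₁ (v₀ ∈ v₁ → v₀ ∈ v₁)}`, and `⌜n+1⌝`
is `{v₀ | v₀ ∈ ⌜n⌝ ∨ ∀v₁ (v₀ ∈ v₁ → ⌜n⌝ ∈ v₁)}`. -/
def numeral : ℕ → Term
  | 0 => sort 0 (neg (all 1 (imp (app (noema 1) (noema 0)) (app (noema 1) (noema 0)))))
  | n + 1 => sort 0 (disj (app (numeral n) (noema 0))
      (all 1 (imp (app (noema 1) (noema 0)) (app (noema 1) (numeral n)))))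

/-- The name `⌜A⌝` of the formula `A`. -/
def code (A : Formula) : Term := numeral A.num

/-- The number of connectives and quantifiers of a formula outside its terms. -/
def rank : {k : Kind} → Expr k → ℕ
  | _, noema _ => 0
  | _, alethizor => 0
  | _, enumerator => 0
  | _, app _ _ => 0
  | _, joint X Y => rank X + rank Y + 1
  | _, all _ A => rank A + 1
  | _, sort _ _ => 0

theorem rank_subst (a : Term) (u : ℕ) {k : Kind} (X : Expr k) (hk : k = .formula) :
    (X.subst a u).rank = X.rank := by
  induction X with
  | noema n => cases hk
  | alethizor => cases hk
  | enumerator => cases hk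
  | app b c => rfl
  | joint X Y ihX ihY => simp [subst, rank, ihX hk, ihY hk]
  | all y A ih =>
    by_cases h : y = u
    · simp [subst, h]
    · simp [subst, h, rank, ih rfl]
  | sort y A => cases hk

end Expr

open Librationism.Expr

/-! ### Classical provability and the enumeration of the cognomina -/

/-- Classical logic in the language: all tautologies, the usual quantifier axioms, all their
generalizations, and modus ponens. -/
inductive Provable : Formula → Prop where
  | taut (A : Formula)
      (h : ∀ v : Formula → Prop, (∀ B C : Formula, v (joint B C) ↔ ¬ v B ∧ ¬ v C) → v A) :
      Provable A
  | vacuous (A : Formula) (x : ℕ) (h : x ∉ A.noemata) : Provable (imp A (all x A))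
  | distrib (A B : Formula) (x : ℕ) :
      Provable (imp (all x (imp A B)) (imp (all x A) (all x B)))
  | spec (A : Formula) (x : ℕ) (a : Term) (h : A.Free a x) :
      Provable (imp (all x A) (A.subst a x))
  | gen (A : Formula) (x : ℕ) (h : Provable A) : Provable (all x A)
  | mp (A B : Formula) (h : Provable (imp A B)) (h' : Provable A) : Provable B

/-- Alphabetological variants, among propositions and among cognomina. -/
inductive Variant : {k : Kind} → Expr k → Expr k → Prop where
  | congruent (A B : Formula) (hA : A.Closed) (hB : B.Closed) (h : Provable (biimp A B)) :
      Variant A B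
  | replace (A B : Formula) (a b : Term) (hA : A.Closed) (hB : B.Closed) (ha : a.Closed)
      (hb : b.Closed) (hab : Variant a b) (h : Variant A (B.replace b a)) : Variant A B
  | alethizor : Variant Expr.alethizor Expr.alethizor
  | enumerator : Variant Expr.enumerator Expr.enumerator
  | joint (c d e f : Term) (hce : Variant c e) (hdf : Variant d f) :
      Variant (Expr.joint c d) (Expr.joint e f)
  | joint_swap (c d e f : Term) (hcf : Variant c f) (hde : Variant d e) :
      Variant (Expr.joint c d) (Expr.joint e f)
  | sort (x y : ℕ) (A B : Formula) (hA : (Expr.sort x A).Closed) (hB : (Expr.sort y B).Closed)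
      (h : Variant (ex x A) (ex y B)) : Variant (Expr.sort x A) (Expr.sort y B)

/-- `c` enumerates the cognomina by size up to alphabetological variants: `c n` has the smallest
number among the cognomina that are not in the classes of the `c m` with `m < n`, where `b` is in
the class of `c m` if `c m` is a variant of `b`. Different cognomina can have the same number, and
ties may be broken in any way. -/
def IsEnumeration (c : ℕ → Term) : Prop :=
  ∀ n, (c n).Closed ∧ (∀ m < n, ¬ Variant (c m) (c n)) ∧
    ∀ b : Term, b.Closed → (∀ m < n, ¬ Variant (c m) b) → (c n).num ≤ b.num

/-! ### The semantic process -/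

section Stage

/-! In this section `S` is the set of the formulas that hold at all ordinals from some ordinal
below the present one on, and the present stage of the process is defined from it.

Identity of terms is `∀u (a ∈ u → b ∈ u)`, with `u` ranging also over `T` and `€`, whose members are
themselves described through identity. This is resolved by taking identity of cognomina with respect
to sorts `{v_u | A}` only; the members of `T` and `€` are then closed under it, so that `Ident` is
what the formula `a = b` says (`holds_eqv`).

A noema is a name: at each ordinal `v_n` names a cognomen, and an atomic formula is evaluated with
all its noemata replaced by the cognomina that they name at that ordinal. -/

/-- Identity of the cognomina `a` and `b` at the present ordinal: they are in the same sorts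
`{v_u | A}` without noemata. -/
def Ident (S : Set Formula) (a b : Term) : Prop :=
  ∀ (u : ℕ) (A : Formula), (sort u A).Closed → (A.subst a u ∈ S ↔ A.subst b u ∈ S)

open Classical in
/-- The cognomen that the noema `v_n` names at the present ordinal: `c n` if no earlier noema is
identical with `c n`, and otherwise the cognomen that `v_(n-1)` names. -/
noncomputable def den (c : ℕ → Term) (S : Set Formula) (n : ℕ) : Term :=
  if ∀ m : Fin n, ¬ Ident S (den c S m.1) (c n) then c n
  else if _ : 0 < n then den c S (n - 1)
  else c n -- impossible: the first case holds for `n = 0`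
termination_by n
decreasing_by all_goals omega

/-- `Mem c S b a`: the cognomen `a` is a member of the cognomen `b` at the present ordinal. -/
def Mem (c : ℕ → Term) (S : Set Formula) : (b a : Term) → Prop
  | sort u A, a => A.Free a u ∧ A.subst a u ∈ S
  | joint b d, a => ¬ Mem c S b a ∧ ¬ Mem c S d a
  | alethizor, a => ∃ A : Formula, Ident S a (code A) ∧ A.inst (den c S) ∈ S
  | enumerator, a => ∃ (d : Term) (n : ℕ),
      Ident S a ((pair (numeral n) d).inst (den c S)) ∧
        Ident S (d.inst (den c S)) (den c S n)
  | noema _, _ => False -- not a cognomen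

/-- The formulas that hold at the present ordinal. -/
def Holds (c : ℕ → Term) (S : Set Formula) : Formula → Prop
  | app b a => Mem c S (b.inst (den c S)) (a.inst (den c S))
  | joint A B => ¬ Holds c S A ∧ ¬ Holds c S B
  | all y A => ∀ a : Term, A.Free a y → Holds c S (A.subst a y)
termination_by A => A.rank
decreasing_by
  all_goals simp [rank, rank_subst]

end Stage

/-- The semantic process: `A ∈ process c α` is `α ⊨ A`. -/
def process (c : ℕ → Term) (α : Ordinal.{0}) : Set Formula :=
  {A | Holds c {B | ∃ β : Ordinal.{0}, β < α ∧
    ∀ γ : Ordinal.{0}, β ≤ γ → (hγ : γ < α) → B ∈ process c γ} A}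
termination_by α

/-! ### The clauses of the process

The lemmas below show that the process and the enumeration exist and satisfy the clauses that are
meant to define them. -/

theorem mem_noemata_inst {k : Kind} (X : Expr k) (ρ : ℕ → Term)
    (hρ : ∀ n, (ρ n).Closed ∨ ρ n = noema n) (n : ℕ) :
    n ∈ (X.inst ρ).noemata ↔ n ∈ X.noemata ∧ ρ n = noema n := by
  induction X generalizing ρ with
  | noema m =>
    simp only [inst, noemata, Finset.mem_singleton]
    rcases hρ m with h | h
    · constructor
      · intro h'; rw [Closed] at h; rw [h] at h'; simp at h'
      · rintro ⟨rfl, h'⟩; rw [h'] at h; simp [Closed, noemata] at h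
    · rw [h]; simp only [noemata, Finset.mem_singleton]
      constructor
      · rintro rfl; exact ⟨rfl, h⟩
      · exact fun h => h.1
  | alethizor => simp [inst, noemata]
  | enumerator => simp [inst, noemata]
  | app b a ihb iha => simp [inst, noemata, ihb ρ hρ, iha ρ hρ]; tauto
  | joint X Y ihb iha => simp [inst, noemata, ihb ρ hρ, iha ρ hρ]; tauto
  | all y A ih =>
    simp only [inst, noemata, Finset.mem_sdiff, Finset.mem_singleton]
    rw [ih]
    · by_cases h : n = y <;> simp [h]
    · intro m; by_cases h : m = y
      · subst h; simp
      · simp [h, hρ m]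
  | sort y A ih =>
    simp only [inst, noemata, Finset.mem_sdiff, Finset.mem_singleton]
    rw [ih]
    · by_cases h : n = y <;> simp [h]
    · intro m; by_cases h : m = y
      · subst h; simp
      · simp [h, hρ m]

theorem closed_inst {k : Kind} (X : Expr k) (ρ : ℕ → Term) (hρ : ∀ n, (ρ n).Closed) :
    (X.inst ρ).Closed := by
  ext n
  rw [mem_noemata_inst X ρ (fun n => Or.inl (hρ n))]
  simp only [Finset.notMem_empty, iff_false, not_and]
  intro _ h
  have := hρ n
  rw [h] at this; simp [Closed, noemata] at this

theorem inst_eq_self {k : Kind} (X : Expr k) (ρ : ℕ → Term)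
    (h : ∀ n ∈ X.noemata, ρ n = noema n) : X.inst ρ = X := by
  induction X generalizing ρ with
  | noema m => exact h m (by simp [noemata])
  | alethizor => rfl
  | enumerator => rfl
  | app b a ihb iha =>
    simp only [inst]
    rw [ihb ρ (fun n hn => h n (by simp [noemata, hn])),
      iha ρ (fun n hn => h n (by simp [noemata, hn]))]
  | joint b a ihb iha =>
    simp only [inst]
    rw [ihb ρ (fun n hn => h n (by simp [noemata, hn])),
      iha ρ (fun n hn => h n (by simp [noemata, hn]))]
  | all y A ih =>
    simp only [inst]
    rw [ih]
    intro n hn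
    by_cases h' : n = y
    · subst h'; simp
    · simp [h', h n (by simp [noemata, hn, h'])]
  | sort y A ih =>
    simp only [inst]
    rw [ih]
    intro n hn
    by_cases h' : n = y
    · subst h'; simp
    · simp [h', h n (by simp [noemata, hn, h'])]

theorem inst_closed {k : Kind} {X : Expr k} (h : X.Closed) (ρ : ℕ → Term) : X.inst ρ = X :=
  inst_eq_self X ρ (by rw [Closed] at h; simp [h])

theorem subst_of_notMem {k : Kind} (X : Expr k) (a : Term) (u : ℕ) (h : u ∉ X.noemata) :
    X.subst a u = X := by
  induction X with
  | noema m => simp [noemata] at h; simp [subst, Ne.symm h]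
  | alethizor => rfl
  | enumerator => rfl
  | app b a ihb iha => simp [noemata] at h; simp [subst, ihb h.1, iha h.2]
  | joint b a ihb iha => simp [noemata] at h; simp [subst, ihb h.1, iha h.2]
  | all y A ih =>
    by_cases hy : y = u
    · simp [subst, hy]
    · simp [noemata, Ne.symm hy] at h; simp [subst, hy, ih h]
  | sort y A ih =>
    by_cases hy : y = u
    · simp [subst, hy]
    · simp [noemata, Ne.symm hy] at h; simp [subst, hy, ih h]

theorem free_of_closed {k : Kind} (X : Expr k) {a : Term} (ha : a.Closed) (u : ℕ) :
    X.Free a u := by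
  rw [Closed] at ha
  induction X <;> simp_all [Free]

theorem fresh_notMem (s : Finset ℕ) : fresh s ∉ s :=
  Nat.sInf_mem (s := {n | n ∉ s}) (Infinite.exists_notMem_finset s)

section
variable (c : ℕ → Term) (S : Set Formula)

theorem den_of_forall (n : ℕ) (h : ∀ m < n, ¬ Ident S (den c S m) (c n)) : den c S n = c n := by
  have h' : ∀ m : Fin n, ¬ Ident S (den c S m.1) (c n) := fun m => h m.1 m.2
  rw [den, if_pos h']

theorem den_of_not_forall (n : ℕ) (h : ¬ ∀ m < n, ¬ Ident S (den c S m) (c n)) :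
    den c S n = den c S (n - 1) := by
  have h' : ¬ ∀ m : Fin n, ¬ Ident S (den c S m.1) (c n) := fun h' => h fun m hm => h' ⟨m, hm⟩
  have hn : 0 < n := by
    rcases Nat.eq_zero_or_pos n with rfl | h''
    · exact absurd (by simp) h
    · exact h''
  rw [den, if_neg h', dif_pos hn]

theorem den_closed (hc : ∀ n, (c n).Closed) (n : ℕ) : (den c S n).Closed := by
  induction n using Nat.strong_induction_on with
  | _ n ih =>
    rw [den]
    split_ifs with h1 h2
    · exact hc n
    · exact ih _ (by omega)
    · exact hc n

theorem ident_symm {a b : Term} (h : Ident S a b) : Ident S b a := fun u A hA => (h u A hA).symm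
theorem ident_trans {a b d : Term} (h : Ident S a b) (h' : Ident S b d) : Ident S a d :=
  fun u A hA => (h u A hA).trans (h' u A hA)

theorem mem_congr {a b : Term} (ha : a.Closed) (hb : b.Closed) (h : Ident S a b) :
    ∀ w : Term, w.Closed → (Mem c S w a ↔ Mem c S w b)
  | noema n, h' => by simp [Closed, noemata] at h'
  | alethizor, _ => by
    simp only [Mem]
    exact exists_congr fun A => and_congr_left fun _ =>
      ⟨fun h' => ident_trans S (ident_symm S h) h', fun h' => ident_trans S h h'⟩
  | enumerator, _ => by
    simp only [Mem]
    exact exists_congr fun A => exists_congr fun n => and_congr_left fun _ =>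
      ⟨fun h' => ident_trans S (ident_symm S h) h', fun h' => ident_trans S h h'⟩
  | joint X Y, hcl => by
    simp only [Closed, noemata, Finset.union_eq_empty] at hcl
    simp only [Mem]
    exact and_congr (not_congr (mem_congr ha hb h X hcl.1))
      (not_congr (mem_congr ha hb h Y hcl.2))
  | sort y A, hcl => by
    simp only [Mem]
    simp only [free_of_closed A ha, free_of_closed A hb, true_and]
    exact h y A hcl

theorem holds_app (a b : Term) :
    Holds c S (app b a) ↔ Mem c S (b.inst (den c S)) (a.inst (den c S)) := by rw [Holds]
theorem holds_joint (A B : Formula) :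
    Holds c S (joint A B) ↔ ¬ Holds c S A ∧ ¬ Holds c S B := by rw [Holds]
theorem holds_all (y : ℕ) (A : Formula) :
    Holds c S (all y A) ↔ ∀ a : Term, A.Free a y → Holds c S (A.subst a y) := by rw [Holds]
theorem holds_neg (A : Formula) : Holds c S (neg A) ↔ ¬ Holds c S A := by
  simp [neg, holds_joint]
theorem holds_conj (A B : Formula) : Holds c S (conj A B) ↔ Holds c S A ∧ Holds c S B := by
  simp [conj, holds_joint]
theorem holds_imp (A B : Formula) : Holds c S (imp A B) ↔ (Holds c S A → Holds c S B) := by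
  simp [imp, holds_joint]
theorem holds_ex (y : ℕ) (A : Formula) :
    Holds c S (ex y A) ↔ ∃ a : Term, A.Free a y ∧ Holds c S (A.subst a y) := by
  simp [ex, holds_all, neg, subst, Free, holds_joint]

theorem holds_joint_term (a b d : Term) :
    Holds c S (app (joint b d) a) ↔ ¬ Holds c S (app b a) ∧ ¬ Holds c S (app d a) := by
  simp [holds_app, inst, Mem]

theorem holds_eqv (hc : ∀ n, (c n).Closed) (a b : Term) :
    Holds c S (eqv a b) ↔ Ident S (a.inst (den c S)) (b.inst (den c S)) := by
  have hf := fresh_notMem (a.noemata ∪ b.noemata)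
  rw [Finset.notMem_union] at hf
  have hA := closed_inst a _ (den_closed c S hc)
  have hB := closed_inst b _ (den_closed c S hc)
  rw [eqv, holds_all]
  have hs : ∀ w : Term, (imp (app (noema (fresh (a.noemata ∪ b.noemata))) a)
      (app (noema (fresh (a.noemata ∪ b.noemata))) b)).subst w (fresh (a.noemata ∪ b.noemata)) =
      imp (app w a) (app w b) := by
    intro w
    simp only [imp, subst, if_true, subst_of_notMem _ _ _ hf.1, subst_of_notMem _ _ _ hf.2]
  simp only [hs, holds_imp, holds_app]
  constructor
  · intro h
    have key : ∀ w : Term, w.Closed →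
        (Mem c S w (a.inst (den c S)) → Mem c S w (b.inst (den c S))) := by
      intro w hw
      have := h w (free_of_closed _ hw _)
      rwa [inst_closed hw] at this
    intro u A hcl
    have k1 := key (sort u A) hcl
    have k2 := key (joint (sort u A) (sort u A)) (by simpa [Closed, noemata] using hcl)
    simp only [Mem, free_of_closed A hA, free_of_closed A hB, true_and, and_self] at k1 k2
    exact ⟨k1, fun h' => by_contra fun h'' => k2 h'' h'⟩
  · intro h w _
    exact (mem_congr c S hA hB h (w.inst (den c S)) (closed_inst w _ (den_closed c S hc))).1

theorem holds_truth (hc : ∀ n, (c n).Closed) (A : Formula) : Holds c S (truth A) ↔ A.inst (den c S) ∈ S := by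
  have hf := fresh_notMem A.noemata
  have hi : A.inst (Function.update (den c S) (fresh A.noemata) (noema (fresh A.noemata))) =
      A.inst (den c S) := by
    have gen : ∀ {k} (X : Expr k) (ρ σ : ℕ → Term), (∀ n ∈ X.noemata, ρ n = σ n) →
        X.inst ρ = X.inst σ := by
      intro k X
      induction X with
      | noema m => intro ρ σ h; exact h m (by simp [noemata])
      | alethizor => intros; rfl
      | enumerator => intros; rfl
      | app b a ihb iha =>
        intro ρ σ h
        simp only [inst]
        rw [ihb ρ σ (fun n hn => h n (by simp [noemata, hn])),
          iha ρ σ (fun n hn => h n (by simp [noemata, hn]))]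
      | joint b a ihb iha =>
        intro ρ σ h
        simp only [inst]
        rw [ihb ρ σ (fun n hn => h n (by simp [noemata, hn])),
          iha ρ σ (fun n hn => h n (by simp [noemata, hn]))]
      | all y A ih =>
        intro ρ σ h
        simp only [inst]
        rw [ih]
        intro n hn
        by_cases h' : n = y
        · subst h'; simp
        · simp [h', h n (by simp [noemata, hn, h'])]
      | sort y A ih =>
        intro ρ σ h
        simp only [inst]
        rw [ih]
        intro n hn
        by_cases h' : n = y
        · subst h'; simp
        · simp [h', h n (by simp [noemata, hn, h'])]
    apply gen
    intro n hn
    have : n ≠ fresh A.noemata := by rintro rfl; exact hf hn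
    simp [this]
  have hn : ∀ u, u ∉ (A.inst (den c S)).noemata := by
    have := closed_inst A _ (den_closed c S hc)
    rw [Closed] at this
    simp [this]
  rw [truth, holds_ex]
  simp only [subst, if_true, holds_app, inst, Mem, hi, subst_of_notMem _ _ _ (hn _)]
  constructor
  · rintro ⟨a, _, _, h⟩; exact h
  · intro h
    exact ⟨alethizor, free_of_closed _ (by rfl) _, free_of_closed _ (by rfl) _, h⟩

theorem closed_numeral (n : ℕ) : (numeral n).Closed := by
  induction n with
  | zero => rfl
  | succ n ih =>
    simp only [Closed] at ih ⊢
    simp only [numeral, noemata, disj, imp, ih]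
    decide

end

/-- The formulas that hold at all ordinals from some ordinal below `α` on, up to `α`. -/
def below (c : ℕ → Term) (α : Ordinal.{0}) : Set Formula :=
  {B | ∃ β : Ordinal.{0}, β < α ∧ ∀ γ : Ordinal.{0}, β ≤ γ → γ < α → B ∈ process c γ}

theorem mem_process (c : ℕ → Term) (α : Ordinal.{0}) (A : Formula) :
    A ∈ process c α ↔ Holds c (below c α) A := by
  rw [process]; rfl

/-- Membership in a sort, for cognomina. -/
theorem process_sort (c : ℕ → Term) (α : Ordinal.{0}) (a : Term) (u : ℕ) (A : Formula)
    (ha : a.Closed) (hA : (sort u A).Closed) :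
    app (sort u A) a ∈ process c α ↔ A.Free a u ∧ ∃ β : Ordinal.{0}, β < α ∧
      ∀ γ : Ordinal.{0}, β ≤ γ → γ < α → A.subst a u ∈ process c γ := by
  rw [mem_process, holds_app, inst_closed ha, inst_closed hA, Mem]; rfl

/-- A noema behaves as the cognomen that it names at the present ordinal. -/
theorem process_app (c : ℕ → Term) (hc : ∀ n, (c n).Closed) (α : Ordinal.{0}) (a b : Term) :
    app b a ∈ process c α ↔
      app (b.inst (den c (below c α))) (a.inst (den c (below c α))) ∈ process c α := by
  have h := den_closed c (below c α) hc
  rw [mem_process, mem_process, holds_app, holds_app, inst_closed (closed_inst b _ h),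
    inst_closed (closed_inst a _ h)]

theorem process_joint (c : ℕ → Term) (α : Ordinal.{0}) (A B : Formula) :
    joint A B ∈ process c α ↔ A ∉ process c α ∧ B ∉ process c α := by
  simp only [mem_process, holds_joint]

theorem process_joint_term (c : ℕ → Term) (α : Ordinal.{0}) (a b d : Term) :
    app (joint b d) a ∈ process c α ↔ app b a ∉ process c α ∧ app d a ∉ process c α := by
  simp only [mem_process, holds_app, inst, Mem]

theorem process_all (c : ℕ → Term) (α : Ordinal.{0}) (y : ℕ) (A : Formula) :
    all y A ∈ process c α ↔ ∀ a : Term, A.Free a y → A.subst a y ∈ process c α := by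
  simp only [mem_process, holds_all]

theorem process_alethizor (c : ℕ → Term) (hc : ∀ n, (c n).Closed) (α : Ordinal.{0}) (a : Term) :
    app alethizor a ∈ process c α ↔
      ∃ A : Formula, conj (eqv a (code A)) (truth A) ∈ process c α := by
  simp only [mem_process, holds_conj, holds_eqv c _ hc, holds_truth c _ hc, holds_app, inst, Mem,
    inst_closed (closed_numeral _), code]

/-- The naming of cognomina by noemata. -/
theorem process_noema (c : ℕ → Term) (hc : ∀ n, (c n).Closed) (α : Ordinal.{0}) (n : ℕ) :
    ((∀ m < n, neg (eqv (noema m) (c n)) ∈ process c α) → eqv (noema n) (c n) ∈ process c α) ∧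
    (¬ (∀ m < n, neg (eqv (noema m) (c n)) ∈ process c α) →
      eqv (noema n) (noema (n - 1)) ∈ process c α) := by
  simp only [mem_process, holds_neg, holds_eqv c _ hc, inst, inst_closed (hc n)]
  constructor
  · intro h
    rw [den_of_forall _ _ _ h]
    exact fun _ _ _ => Iff.rfl
  · intro h
    rw [den_of_not_forall _ _ _ h]
    exact fun _ _ _ => Iff.rfl

theorem process_enumerator (c : ℕ → Term) (hc : ∀ n, (c n).Closed) (α : Ordinal.{0}) (a : Term) :
    app enumerator a ∈ process c α ↔ ∃ (d : Term) (n : ℕ),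
      conj (eqv a (pair (numeral n) d)) (eqv d (noema n)) ∈ process c α := by
  simp only [mem_process, holds_conj, holds_eqv c _ hc, holds_app, inst, Mem]

/-! There is an enumeration of the cognomina. -/
/-- The nesting depth of the joints of a term outside its sorts. -/
def depth : {k : Kind} → Expr k → ℕ
  | _, joint X Y => max (depth X) (depth Y) + 1
  | _, _ => 0

theorem variant_depth {k : Kind} {X Y : Expr k} (h : Variant X Y) (hk : k = .term) :
    depth X = depth Y := by
  induction h with
  | congruent => cases hk
  | replace => cases hk
  | alethizor => rfl
  | enumerator => rfl
  | joint c d e f _ _ h1 h2 => simp [depth, h1 hk, h2 hk]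
  | joint_swap c d e f _ _ h1 h2 => simp [depth, h1 hk, h2 hk, max_comm]
  | sort => rfl

/-- Cognomina of every depth. -/
def tower : ℕ → Term
  | 0 => alethizor
  | n + 1 => joint (tower n) (tower n)
theorem tower_closed (n : ℕ) : (tower n).Closed := by
  induction n with
  | zero => rfl
  | succ n ih => simp only [Closed] at ih; simp [tower, Closed, noemata, ih]
theorem tower_depth (n : ℕ) : depth (tower n) = n := by
  induction n with
  | zero => rfl
  | succ n ih => simp [tower, depth, ih]

theorem exists_enumeration : ∃ c, IsEnumeration c := by
  classical
  have step : ∀ (n : ℕ) (c : ∀ m < n, Term), ∃ t : Term, t.Closed ∧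
      (∀ m hm, ¬ Variant (c m hm) t) ∧
      ∀ b : Term, b.Closed → (∀ m hm, ¬ Variant (c m hm) b) → t.num ≤ b.num := by
    intro n c
    let P : Set Term := {t | t.Closed ∧ ∀ m hm, ¬ Variant (c m hm) t}
    have hP : P.Nonempty := by
      let N := ∑ m : Fin n, depth (c m m.2) + 1
      refine ⟨tower N, tower_closed _, fun m hm h => ?_⟩
      have := variant_depth h rfl
      rw [tower_depth] at this
      have h2 := Finset.single_le_sum (f := fun m : Fin n => depth (c m m.2))
        (fun _ _ => Nat.zero_le _) (Finset.mem_univ ⟨m, hm⟩)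
      simp only [N] at this
      simp only at h2
      omega
    refine ⟨Function.argminOn Expr.num P hP, (Function.argminOn_mem Expr.num P hP).1,
      (Function.argminOn_mem Expr.num P hP).2, fun b hb hb' => ?_⟩
    exact Function.argminOn_le Expr.num P (show b ∈ P from ⟨hb, hb'⟩)
  choose f hf using step
  let c : ℕ → Term := fun n => Nat.strongRec (motive := fun _ => Term) f n
  have hcn : ∀ n, c n = f n (fun m _ => c m) := by
    intro n; simp only [c]; rw [Nat.strongRec_eq]
  refine ⟨c, fun n => ?_⟩
  rw [hcn n]
  exact hf n _

/-! ### Covering and stabilizing ordinals -/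

/-- `⊨_γ`, the set of the formulas `A` with `γ ⊨ 𝕋A`. -/
def truths (c : ℕ → Term) (γ : Ordinal.{0}) : Set Formula := {A | truth A ∈ process c γ}

def IN (c : ℕ → Term) : Set Formula :=
  {A | ∃ β : Ordinal.{0}, ∀ γ : Ordinal.{0}, β ≤ γ → A ∈ truths c γ}

def OUT (c : ℕ → Term) : Set Formula :=
  {A | ∃ β : Ordinal.{0}, ∀ γ : Ordinal.{0}, β ≤ γ → A ∉ truths c γ}

def STAB (c : ℕ → Term) : Set Formula := IN c ∪ OUT c

def UNSTAB (c : ℕ → Term) : Set Formula := (STAB c)ᶜ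

/-- The limit ordinal `κ` covers the process. -/
def Covers (c : ℕ → Term) (κ : Ordinal.{0}) : Prop :=
  Order.IsSuccLimit κ ∧
    ∀ γ : Ordinal.{0}, κ ≤ γ → IN c ⊆ truths c γ ∧ truths c γ ⊆ IN c ∪ UNSTAB c

/-- The limit ordinal `σ` stabilizes the process. -/
def Stabilizes (c : ℕ → Term) (σ : Ordinal.{0}) : Prop :=
  Covers c σ ∧ truths c σ ⊆ IN c

end Librationism

/-! A stage of the process depends on its predecessors only through `below c α`, the set of formulas
holding eventually below `α`. So if `below` agrees at `μ` and `ν`, the process continues identically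
from both (`below_add_congr`).

There are only countably many formulas, so a closing-off argument below `ω₁` gives a countable limit
`κ` with `below c κ = below c ω₁`, such that everything in this set already holds at all stages from
`κ` up to `ω₁` (`exists_countable_period`). The segment from `κ` to `ω₁` then repeats forever, and
`below c κ` returns at the end of every block, also after limit many blocks
(`IsPeriod.below_add_mul`).

Hence every stage past `κ` recurs arbitrarily late, which makes `κ` cover the process. To stabilize
it, the formulas true at `κ` must stay true. What holds eventually below `κ` holds ever after, but
`𝕋A` also depends on what the noemata of `A` name. These names depend only on identity, and identity
can only be lost as the process goes on (`ident_antitone`). Since `κ` recurs, none is lost after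
`κ`, and the names are constant from there. Well-ordering then gives a least stabilizing ordinal, at
most `κ`. -/

namespace Librationism

open Librationism.Expr

/-! ### There are countably many expressions -/

/-- An injective numbering of the expressions of each kind. -/
def godel : {k : Kind} → Expr k → ℕ
  | _, noema n => Nat.pair 0 n
  | _, alethizor => Nat.pair 1 0
  | _, enumerator => Nat.pair 2 0
  | _, app b a => Nat.pair 3 (Nat.pair (godel b) (godel a))
  | _, joint X Y => Nat.pair 4 (Nat.pair (godel X) (godel Y))
  | _, all y A => Nat.pair 5 (Nat.pair y (godel A))
  | _, sort y A => Nat.pair 6 (Nat.pair y (godel A))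

theorem godel_injective {k : Kind} : Function.Injective (godel (k := k)) := by
  intro X
  induction X with
  | noema n => intro Y h; cases Y <;> simp_all [godel, Nat.pair_eq_pair]
  | alethizor => intro Y h; cases Y <;> simp_all [godel, Nat.pair_eq_pair]
  | enumerator => intro Y h; cases Y <;> simp_all [godel, Nat.pair_eq_pair]
  | app b a ihb iha =>
    intro Y h
    cases Y with
    | app b' a' =>
      simp only [godel, Nat.pair_eq_pair, true_and] at h
      rw [ihb h.1, iha h.2]
    | _ => simp [godel, Nat.pair_eq_pair] at h
  | joint X Z ihX ihZ =>
    intro Y h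
    cases Y with
    | joint X' Z' =>
      simp only [godel, Nat.pair_eq_pair, true_and] at h
      rw [ihX h.1, ihZ h.2]
    | _ => simp [godel, Nat.pair_eq_pair] at h
  | all y A ih =>
    intro Y h
    cases Y with
    | all y' A' =>
      simp only [godel, Nat.pair_eq_pair, true_and] at h
      rw [h.1, ih h.2]
    | _ => simp [godel, Nat.pair_eq_pair] at h
  | sort y A ih =>
    intro Y h
    cases Y with
    | sort y' A' =>
      simp only [godel, Nat.pair_eq_pair, true_and] at h
      rw [h.1, ih h.2]
    | _ => simp [godel, Nat.pair_eq_pair] at h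

instance (k : Kind) : Countable (Expr k) := godel_injective.countable

/-! ### Recurrence in the process -/

theorem process_congr {c : ℕ → Term} {μ ν : Ordinal.{0}} (h : below c μ = below c ν) :
    process c μ = process c ν := by
  ext A; rw [mem_process, mem_process, h]

/-- Separates the two ways in which truth can vary with `γ`: through the names of the noemata, and
through what holds eventually below `γ`. -/
theorem mem_truths {c : ℕ → Term} (hc : ∀ n, (c n).Closed) (γ : Ordinal.{0}) (A : Formula) :
    A ∈ truths c γ ↔ A.inst (den c (below c γ)) ∈ below c γ := by
  rw [truths, Set.mem_ofPred_eq, mem_process, holds_truth _ _ hc]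

theorem truths_congr {c : ℕ → Term} {μ ν : Ordinal.{0}} (h : below c μ = below c ν) :
    truths c μ = truths c ν := by
  simp only [truths, process_congr h]

/-- What holds eventually below `μ + ξ`, for `0 < ξ`, depends only on the stages from `μ` on. -/
theorem mem_below_add {c : ℕ → Term} {μ ξ : Ordinal.{0}} (hξ : 0 < ξ) (B : Formula) :
    B ∈ below c (μ + ξ) ↔
      ∃ η < ξ, ∀ ζ, η ≤ ζ → ζ < ξ → B ∈ process c (μ + ζ) := by
  constructor
  · rintro ⟨β, hβ, h⟩
    refine ⟨β - μ, ?_, fun ζ h1 h2 => h _ ?_ (by gcongr)⟩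
    · exact Ordinal.sub_lt_of_lt_add hβ hξ
    · exact Ordinal.sub_le.1 h1
  · rintro ⟨η, hη, h⟩
    refine ⟨μ + η, by gcongr, fun γ h1 h2 => ?_⟩
    obtain ⟨ζ, rfl⟩ : ∃ ζ, γ = μ + ζ :=
      ⟨γ - μ, (Ordinal.add_sub_cancel_of_le (le_self_add.trans h1)).symm⟩
    exact h ζ (by simpa using h1) (by simpa using h2)

/-- The process goes on in the same way from stages below which the same formulas hold
eventually. -/
theorem below_add_congr {c : ℕ → Term} {μ ν : Ordinal.{0}} (h : below c μ = below c ν)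
    (ξ : Ordinal.{0}) : below c (μ + ξ) = below c (ν + ξ) := by
  induction ξ using WellFoundedLT.induction with
  | _ ξ ih =>
    rcases eq_zero_or_pos ξ with rfl | hξ
    · simpa using h
    · ext B
      rw [mem_below_add hξ, mem_below_add hξ]
      refine exists_congr fun η => and_congr_right fun _ => forall_congr' fun ζ =>
        forall_congr' fun _ => forall_congr' fun hζ => ?_
      rw [process_congr (ih ζ hζ)]

/-- The process is periodic from `κ` on, with period `π`, and everything that holds eventually
below `κ` holds throughout the first period. -/
structure IsPeriod (c : ℕ → Term) (κ π : Ordinal.{0}) : Prop where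
  pos : 0 < π
  below_add : below c (κ + π) = below c κ
  below_subset : ∀ r < π, below c κ ⊆ process c (κ + r)

/-! ### Consequences of a period: recurrence and covering. -/

namespace IsPeriod

variable {c : ℕ → Term} {κ π : Ordinal.{0}}

/-- By induction, all blocks of length `π` before the `ξ`-th are copies of the first. So
`below_subset` applies in each of them, which gives one inclusion and carries the induction through
limit `ξ`. For the other, the final part of a single block is enough. -/
theorem below_add_mul (h : IsPeriod c κ π) (ξ : Ordinal.{0}) :
    below c (κ + π * ξ) = below c κ := by
  induction ξ using WellFoundedLT.induction with
  | _ ξ ih =>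
    rcases eq_zero_or_pos ξ with rfl | hξ
    · simp
    have hpos : 0 < π * ξ := mul_pos h.pos hξ
    ext B
    rw [mem_below_add hpos]
    constructor
    · rintro ⟨η, hη, hB⟩
      obtain ⟨q, hq, r, hr, rfl⟩ := Ordinal.lt_mul_iff.1 hη
      -- The witness lies in block `q` at offset `r`. The rest of that block shows that the formula
      -- holds eventually below its end, where `below` is the same as at `κ`.
      rw [← h.below_add, ← below_add_congr (ih q hq) π, mem_below_add h.pos]
      refine ⟨r, hr, fun ζ h1 h2 => ?_⟩
      rw [add_assoc]
      exact hB _ (by gcongr) (Ordinal.lt_mul_iff.2 ⟨q, hq, ζ, h2, rfl⟩)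
    · intro hB
      refine ⟨0, hpos, fun ζ _ hζ => ?_⟩
      obtain ⟨q, hq, r, hr, rfl⟩ := Ordinal.lt_mul_iff.1 hζ
      rw [← add_assoc, process_congr (below_add_congr (ih q hq) r)]
      exact h.below_subset r hr hB

/-- Insert `β` whole blocks after `κ`: they have length `π * β ≥ β`, and the offset `γ - κ` then
leads to a copy of `γ`. -/
theorem exists_recurrence (h : IsPeriod c κ π) {γ : Ordinal.{0}} (hγ : κ ≤ γ) (β : Ordinal.{0}) :
    ∃ γ', β ≤ γ' ∧ below c γ' = below c γ := by
  refine ⟨κ + π * β + (γ - κ), ?_, ?_⟩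
  · exact (Ordinal.le_mul_right β h.pos).trans (le_add_self.trans le_self_add)
  · rw [below_add_congr (h.below_add_mul β), Ordinal.add_sub_cancel_of_le hγ]

/-- Division by `π` with remainder moves any later stage back into the first block. -/
theorem subset_process (h : IsPeriod c κ π) {γ : Ordinal.{0}} (hγ : κ ≤ γ) :
    below c κ ⊆ process c γ := by
  obtain ⟨ζ, rfl⟩ : ∃ ζ, γ = κ + ζ := ⟨γ - κ, (Ordinal.add_sub_cancel_of_le hγ).symm⟩
  rw [← Ordinal.div_add_mod ζ π, ← add_assoc,
    process_congr (below_add_congr (h.below_add_mul (ζ / π)) (ζ % π))]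
  exact h.below_subset _ (Ordinal.mod_lt _ h.pos.ne')

theorem subset_below (h : IsPeriod c κ π) {γ : Ordinal.{0}} (hγ : κ ≤ γ) :
    below c κ ⊆ below c γ := by
  rcases hγ.eq_or_lt with rfl | hlt
  · exact subset_rfl
  · exact fun B hB => ⟨κ, hlt, fun δ hδ _ => h.subset_process hδ hB⟩

/-- Recurrence alone suffices: a copy of `γ` occurs past any threshold `β`, so the truths at `γ`
include whatever is eventually always true and exclude whatever is eventually never true. -/
theorem covers (h : IsPeriod c κ π) (hκ : Order.IsSuccLimit κ) : Covers c κ := by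
  refine ⟨hκ, fun γ hγ => ⟨?_, fun A hA => ?_⟩⟩
  · rintro A ⟨β, hβ⟩
    obtain ⟨γ', h1, h2⟩ := h.exists_recurrence hγ β
    rw [← truths_congr h2]
    exact hβ γ' h1
  · by_cases hin : A ∈ IN c
    · exact Or.inl hin
    · refine Or.inr fun hst => hst.elim hin ?_
      rintro ⟨β, hβ⟩
      obtain ⟨γ', h1, h2⟩ := h.exists_recurrence hγ β
      exact hβ γ' h1 (by rwa [truths_congr h2])

end IsPeriod

/-! ### Identity is never gained -/

/-- Makes `{v₁ | a = v₁}` usable as a test sort for identity with `a`. Index `1` is chosen because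
the bound noema of `eqv` is then `v₀` both before and after the substitution, so that the two sides
agree syntactically. -/
theorem eqv_subst_noema {a b : Term} (ha : a.Closed) (hb : b.Closed) :
    (eqv a (noema 1)).subst b 1 = eqv a b := by
  have h0 : fresh (a.noemata ∪ (noema 1).noemata) = 0 := by
    rw [Closed] at ha
    rw [fresh, ha]
    exact Nat.sInf_eq_zero.2 (Or.inl (by simp [noemata]))
  have h1 : fresh (a.noemata ∪ b.noemata) = 0 := by
    rw [Closed] at ha hb
    rw [fresh, ha, hb]
    exact Nat.sInf_eq_zero.2 (Or.inl (by simp))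
  have h2 : a.subst b 1 = a := subst_of_notMem _ _ _ (by rw [Closed] at ha; simp [ha])
  simp [eqv, h0, h1, subst, imp, h2]

theorem closed_sort_eqv {a : Term} (ha : a.Closed) : (sort 1 (eqv a (noema 1))).Closed := by
  rw [Closed] at ha ⊢
  ext n
  simp [eqv, noemata, imp, ha]
  tauto

/-- Identity at `γ > 0` applies to the sort `{v₁ | a = v₁}`. As `a = a` always holds, `a = b` must
hold eventually below `γ`, so at some stage in `[δ, γ)`, and induction leads down to `δ`. -/
theorem ident_antitone {c : ℕ → Term} (hc : ∀ n, (c n).Closed) {a b : Term} (ha : a.Closed)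
    (hb : b.Closed) {γ δ : Ordinal.{0}} (hδ : δ ≤ γ) (h : Ident (below c γ) a b) :
    Ident (below c δ) a b := by
  have hiff : ∀ {d : Term} (_ : d.Closed) (ε : Ordinal.{0}),
      eqv a d ∈ process c ε ↔ Ident (below c ε) a d := fun hd ε => by
    rw [mem_process, holds_eqv _ _ hc, inst_closed ha, inst_closed hd]
  induction γ using WellFoundedLT.induction with
  | _ γ ih =>
    rcases hδ.eq_or_lt with rfl | hlt
    · exact h
    have key := h 1 _ (closed_sort_eqv ha)
    rw [eqv_subst_noema ha ha, eqv_subst_noema ha hb] at key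
    obtain ⟨β, hβ, hB⟩ :=
      key.1 ⟨δ, hlt, fun ε _ _ => (hiff ha ε).2 fun _ _ _ => Iff.rfl⟩
    have hm : max β δ < γ := max_lt hβ hlt
    exact ih _ hm (le_max_right _ _) ((hiff hb _).1 (hB _ (le_max_left _ _) hm))

/-- The recursion for names consults `S` only through identity of cognomina. -/
theorem den_congr {c : ℕ → Term} (hc : ∀ n, (c n).Closed) {S S' : Set Formula}
    (h : ∀ a b : Term, a.Closed → b.Closed → (Ident S a b ↔ Ident S' a b)) :
    den c S = den c S' := by
  funext n
  induction n using Nat.strong_induction_on with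
  | _ n ih =>
    have hiff : (∀ m < n, ¬ Ident S (den c S m) (c n)) ↔
        ∀ m < n, ¬ Ident S' (den c S' m) (c n) := by
      refine forall_congr' fun m => forall_congr' fun hm => not_congr ?_
      rw [ih m hm]
      exact h _ _ (den_closed c S' hc m) (hc n)
    by_cases hd : ∀ m < n, ¬ Ident S (den c S m) (c n)
    · rw [den_of_forall _ _ _ hd, den_of_forall _ _ _ (hiff.1 hd)]
    · have hn : 0 < n := by
        rcases Nat.eq_zero_or_pos n with rfl | hn
        · exact absurd (by simp) hd
        · exact hn
      rw [den_of_not_forall _ _ _ hd, den_of_not_forall _ _ _ (mt hiff.2 hd), ih _ (by omega)]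

theorem IsPeriod.den_eq {c : ℕ → Term} {κ π : Ordinal.{0}} (h : IsPeriod c κ π)
    (hc : ∀ n, (c n).Closed) {γ : Ordinal.{0}} (hγ : κ ≤ γ) :
    den c (below c γ) = den c (below c κ) := by
  refine den_congr hc fun a b ha hb => ⟨ident_antitone hc ha hb hγ, fun hi => ?_⟩
  -- An identity at `κ` also holds at a copy of `κ` past `γ`, and from there it passes down to `γ`.
  obtain ⟨γ', h1, h2⟩ := h.exists_recurrence le_rfl γ
  rw [← h2] at hi
  exact ident_antitone hc ha hb h1 hi

theorem IsPeriod.stabilizes {c : ℕ → Term} {κ π : Ordinal.{0}} (h : IsPeriod c κ π)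
    (hc : ∀ n, (c n).Closed) (hκ : Order.IsSuccLimit κ) : Stabilizes c κ := by
  refine ⟨h.covers hκ, fun A hA => ⟨κ, fun γ hγ => ?_⟩⟩
  rw [mem_truths hc] at hA ⊢
  rw [h.den_eq hc hγ]
  exact h.subset_below hγ hA

/-! ### A countable stabilizing ordinal -/

open Ordinal

/-- Below some countable limit ordinal the same formulas hold eventually as below `ω₁`. -/
theorem exists_countable_period (c : ℕ → Term) :
    ∃ κ < ω₁, Order.IsSuccLimit κ ∧ ∃ π, IsPeriod c κ π := by
  have hlim : Order.IsSuccLimit ω₁ := Cardinal.isSuccLimit_omega 1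
  -- For `B` holding eventually below `ω₁`, a threshold `e B`; for other `B` the value `0` is a
  -- dummy.
  have hE : ∀ B : Formula, ∃ β < ω₁, B ∈ below c ω₁ → ∀ γ, β ≤ γ → γ < ω₁ → B ∈ process c γ := by
    intro B
    by_cases hB : B ∈ below c ω₁
    · obtain ⟨β, hβ, h⟩ := hB
      exact ⟨β, hβ, fun _ => h⟩
    · exact ⟨0, hlim.bot_lt, fun h => absurd h hB⟩
  choose e he he' using hE
  -- For the remaining `B`, a stage `u B β` at or after `β` where `B` fails; again `0` is a dummy.
  have hU : ∀ (B : Formula) (β : Ordinal.{0}), ∃ γ < ω₁, β < ω₁ → B ∉ below c ω₁ →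
      β ≤ γ ∧ B ∉ process c γ := by
    intro B β
    by_cases hB : β < ω₁ ∧ B ∉ below c ω₁
    · have hn : ¬ ∀ γ, β ≤ γ → γ < ω₁ → B ∈ process c γ := fun h => hB.2 ⟨β, hB.1, h⟩
      push Not at hn
      obtain ⟨γ, h1, h2, h3⟩ := hn
      exact ⟨γ, h2, fun _ _ => ⟨h1, h3⟩⟩
    · exact ⟨0, hlim.bot_lt, fun h1 h2 => absurd ⟨h1, h2⟩ hB⟩
  choose u hu hu' using hU
  -- `f β` lies strictly beyond `β` and beyond one failure after `β` of every formula that keeps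
  -- failing. It stays below `ω₁` because the supremum is over countably many formulas.
  let f : Ordinal.{0} → Ordinal.{0} := fun β => max (Order.succ β) (⨆ B, Order.succ (u B β))
  have hf : ∀ β < ω₁, f β < ω₁ := fun β hβ =>
    max_lt (hlim.succ_lt hβ) (iSup_lt_omega_one fun B => hlim.succ_lt (hu B β))
  have hfu : ∀ B β, u B β < f β := fun B β =>
    (Order.lt_succ _).trans_le ((Ordinal.le_iSup _ B).trans (le_max_right _ _))
  have hflt : ∀ β, β < f β := fun β => (Order.lt_succ β).trans_le (le_max_left _ _)
  -- Starting at the supremum of the thresholds, every formula holding eventually below `ω₁` holds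
  -- from `s 0` up to `ω₁`.
  let s : ℕ → Ordinal.{0} := fun n => f^[n] (⨆ B, e B)
  have hs_succ : ∀ n, s (n + 1) = f (s n) := fun n => Function.iterate_succ_apply' f n _
  have hs : ∀ n, s n < ω₁ := by
    intro n
    induction n with
    | zero => exact iSup_lt_omega_one he
    | succ n ih => rw [hs_succ]; exact hf _ ih
  let κ := ⨆ n, s n
  have hκ : κ < ω₁ := iSup_lt_omega_one hs
  have hsκ : ∀ n, s n < κ := fun n =>
    ((hflt (s n)).trans_eq (hs_succ n).symm).trans_le (Ordinal.le_iSup s (n + 1))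
  have hκlim : Order.IsSuccLimit κ := by
    rw [Ordinal.isSuccLimit_iff, Order.isSuccPrelimit_iff_succ_lt]
    refine ⟨((zero_le).trans_lt (hsκ 0)).ne', fun β hβ => ?_⟩
    obtain ⟨n, hn⟩ := Ordinal.lt_iSup_iff.1 hβ
    exact (Order.succ_le_of_lt hn).trans_lt (hsκ n)
  have hin : ∀ B ∈ below c ω₁, ∀ γ, s 0 ≤ γ → γ < ω₁ → B ∈ process c γ := fun B hB γ h1 h2 =>
    he' B hB γ ((Ordinal.le_iSup e B).trans h1) h2
  have hbelow : below c κ = below c ω₁ := by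
    ext B
    constructor
    · rintro ⟨β, hβ, h⟩
      by_contra hB
      -- Between `s n` and `s (n + 1)` there is a failure of `B`, above the supposed threshold `β`
      -- and below `κ`.
      obtain ⟨n, hn⟩ := Ordinal.lt_iSup_iff.1 hβ
      obtain ⟨h1, h2⟩ := hu' B (s n) (hs n) hB
      refine h2 (h _ (hn.le.trans h1) ((hfu B (s n)).trans ?_))
      rw [← hs_succ]
      exact hsκ (n + 1)
    · exact fun hB => ⟨s 0, hsκ 0, fun γ h1 h2 => hin B hB γ h1 (h2.trans hκ)⟩
  -- The period is the distance from `κ` to `ω₁`, so the first block ends exactly at `ω₁`.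
  have hadd : κ + (ω₁ - κ) = ω₁ := Ordinal.add_sub_cancel_of_le hκ.le
  refine ⟨κ, hκ, hκlim, ω₁ - κ, ⟨?_, by rw [hadd, hbelow], fun r hr B hB => ?_⟩⟩
  · rw [Ordinal.lt_sub]; simpa using hκ
  · refine hin B (hbelow ▸ hB) _ ((hsκ 0).le.trans le_self_add) ?_
    rw [← hadd]
    gcongr

end Librationism

theorem mainTheorem4 (c : ℕ → Librationism.Term) (hc : Librationism.IsEnumeration c) :
    ∃ σ : Ordinal.{0}, IsLeast {τ : Ordinal.{0} | Librationism.Stabilizes c τ} σ ∧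
      σ.card ≤ Cardinal.aleph0 := by
  obtain ⟨κ, hκ, hlim, π, hπ⟩ := Librationism.exists_countable_period c
  have hst : Librationism.Stabilizes c κ := hπ.stabilizes (fun n => (hc n).1) hlim
  have hne : {τ : Ordinal.{0} | Librationism.Stabilizes c τ}.Nonempty := ⟨κ, hst⟩
  refine ⟨sInf {τ | Librationism.Stabilizes c τ}, ⟨csInf_mem hne, fun τ hτ => csInf_le' hτ⟩, ?_⟩
  have hlt := (csInf_le' hst : sInf {τ | Librationism.Stabilizes c τ} ≤ κ).trans_lt hκ
  -- Having cardinality at most `ℵ₀` amounts to lying below `ω₁`, the initial ordinal of `ℵ₁`.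
  rw [← Cardinal.lt_aleph_one_iff, ← Cardinal.lt_ord, Cardinal.ord_aleph]
  exact hlt
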